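/- Let $\mathbb{F}$ be an arbitrary field. For $h\in\mathbb{F}[x]$ let $\mathsf{A}_h$ be the unital associative $\mathbb{F}$-algebra with generators $x,y$ and defining relation $yx=xy+h(x)$. For a commutative ring $R$, a ring automorphism $\sigma$ of $R$ and $a\in R$, the generalized Weyl algebra $R(\sigma,a)$ is the ring generated over $R$ by $x$ and $y$ subject to the relations $$yb=\sigma(b)y,\qquad bx=x\sigma(b),\qquad xy=a,\qquad yx=\sigma(a)\qquad\text{for all } b\in R.$$ (1) For all $h,g\in\mathbb{F}[x]$, $\mathsf{A}_h\cong\mathsf{A}_g$ as $\mathbb{F}$-algebras if and only if there are $\alpha,\beta,\nu\in\mathbb{F}$ with $\alpha\nu\neq 0$ and $g(x)=\nu\,h(\alpha x+\beta)$. (2) If $h\in\mathbb{F}[x]$ is not constant, then $\mathsf{A}_h$ is not isomorphic, even as a ring, to any generalized Weyl algebra $\mathbb{F}[t](\sigma,a)$ over the polynomial ring $\mathbb{F}[t]$, where $\sigma$ is any ring automorphism of $\mathbb{F}[t]$ and $a\in\mathbb{F}[t]$. -/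

import Mathlib

open Polynomial

/-- The defining relation `y x = x y + h(x)` on the free algebra `F⟨x, y⟩`, where the generator
with index `0` is `x` and the one with index `1` is `y`. -/
inductive AhRel {F : Type*} [Field F] (h : F[X]) :
    FreeAlgebra F (Fin 2) → FreeAlgebra F (Fin 2) → Prop
  | comm : AhRel h
      (FreeAlgebra.ι F 1 * FreeAlgebra.ι F 0)
      (FreeAlgebra.ι F 0 * FreeAlgebra.ι F 1 + aeval (FreeAlgebra.ι F (0 : Fin 2)) h)

/-- The unital associative `F`-algebra `A_h` with generators `x`, `y` and defining relation
`y x = x y + h(x)`. -/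
abbrev Ah {F : Type*} [Field F] (h : F[X]) : Type _ :=
  RingQuot (AhRel h)

/-- Generators of a generalized Weyl algebra over `R`: one symbol for each element of `R`,
and the two symbols `x` and `y`. -/
inductive GWAGen (R : Type*) : Type _
  | coeff (b : R) : GWAGen R
  | x : GWAGen R
  | y : GWAGen R

/-- The defining relations of the generalized Weyl algebra `R(σ, a)` on the free ring on
`GWAGen R`. The first three say that `b ↦ coeff b` is a unital ring homomorphism; the others are
`y b = σ(b) y`, `b x = x σ(b)`, `x y = a` and `y x = σ(a)`. -/
inductive GWARel {R : Type*} [CommRing R] (σ : R ≃+* R) (a : R) :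
    FreeAlgebra ℤ (GWAGen R) → FreeAlgebra ℤ (GWAGen R) → Prop
  | coeff_one : GWARel σ a
      (FreeAlgebra.ι ℤ (GWAGen.coeff 1)) 1
  | coeff_add (b c : R) : GWARel σ a
      (FreeAlgebra.ι ℤ (GWAGen.coeff (b + c)))
      (FreeAlgebra.ι ℤ (GWAGen.coeff b) + FreeAlgebra.ι ℤ (GWAGen.coeff c))
  | coeff_mul (b c : R) : GWARel σ a
      (FreeAlgebra.ι ℤ (GWAGen.coeff (b * c)))
      (FreeAlgebra.ι ℤ (GWAGen.coeff b) * FreeAlgebra.ι ℤ (GWAGen.coeff c))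
  | y_coeff (b : R) : GWARel σ a
      (FreeAlgebra.ι ℤ GWAGen.y * FreeAlgebra.ι ℤ (GWAGen.coeff b))
      (FreeAlgebra.ι ℤ (GWAGen.coeff (σ b)) * FreeAlgebra.ι ℤ GWAGen.y)
  | coeff_x (b : R) : GWARel σ a
      (FreeAlgebra.ι ℤ (GWAGen.coeff b) * FreeAlgebra.ι ℤ GWAGen.x)
      (FreeAlgebra.ι ℤ GWAGen.x * FreeAlgebra.ι ℤ (GWAGen.coeff (σ b)))
  | x_y : GWARel σ a
      (FreeAlgebra.ι ℤ GWAGen.x * FreeAlgebra.ι ℤ GWAGen.y)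
      (FreeAlgebra.ι ℤ (GWAGen.coeff a))
  | y_x : GWARel σ a
      (FreeAlgebra.ι ℤ GWAGen.y * FreeAlgebra.ι ℤ GWAGen.x)
      (FreeAlgebra.ι ℤ (GWAGen.coeff (σ a)))

/-- The generalized Weyl algebra `R(σ, a)` over a commutative ring `R` (in which every element
`a` is central): the ring generated over `R` by `x` and `y` subject to `y b = σ(b) y`,
`b x = x σ(b)` for all `b` in `R`, `x y = a` and `y x = σ(a)`. -/
abbrev GWA {R : Type*} [CommRing R] (σ : R ≃+* R) (a : R) : Type _ :=
  RingQuot (GWARel σ a)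

/-! Every element of `A_h` is uniquely `∑ f_j(x) y^j`, and leading coefficients in `y` multiply. So
`A_h` is a domain whose units are the nonzero scalars (`leadingCoeff_toPoly_mul`,
`exists_eq_algebraMap_of_mul_eq_one`). Its commutators lie in `h A_h`, the kernel of the map onto
`(F[x]/(h))[Y]`.

(1) An isomorphism `φ : A_h → A_g` sends the commutator `h = yx - xy` into `g A_g`. The same holds
for its inverse, so the cofactors are units and `φ(h) = c g` with `c` a scalar. If `h` is not
constant, `x` divides `h - h(0)`, so additivity of degrees puts `φ(x)` in `F[x]`. By symmetry `φ`
restricts to an automorphism of `F[x]`, which is affine; this yields `g`. The converse is an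
explicit change of variables.

(2) If `A_h ≅ F[t](σ, a)`, the domain property gives `a ≠ 0`. Units and leading coefficients force
`σ(t) = t + β`, and noncommutativity gives `β ≠ 0`. In the commutative ring `(F[x]/(h))[Y]` the
relation `y t = (t + β) y` then kills `y`, and likewise `x`. So `F[t]` maps onto this ring with `a ↦
0`, which is impossible because `F[t]/(a)` is Artinian while `Y` satisfies no relation `Y^n =
Y^(n+1) s`. -/

namespace Ah

/-! ### Presentation and commutation rule of `A_h`. -/

section Presentation

variable {F : Type*} [Field F] (h : F[X])

/-- The generator `x` of `A_h`. -/
def x : Ah h := RingQuot.mkAlgHom F (AhRel h) (FreeAlgebra.ι F 0)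

/-- The generator `y` of `A_h`. -/
def y : Ah h := RingQuot.mkAlgHom F (AhRel h) (FreeAlgebra.ι F 1)

theorem y_mul_x : y h * x h = x h * y h + aeval (x h) h := by
  have := RingQuot.mkAlgHom_rel F (AhRel.comm (h := h))
  rw [map_mul, map_add, map_mul, ← aeval_algHom_apply] at this
  exact this

variable {h}

/-- The universal property of `A_h`. -/
def lift {S : Type*} [Ring S] [Algebra F S] (u v : S) (huv : v * u = u * v + aeval u h) :
    Ah h →ₐ[F] S :=
  RingQuot.liftAlgHom F ⟨FreeAlgebra.lift F ![u, v], by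
    rintro _ _ ⟨⟩
    simpa [← aeval_algHom_apply] using huv⟩

@[simp]
theorem lift_x {S : Type*} [Ring S] [Algebra F S] (u v : S) (huv : v * u = u * v + aeval u h) :
    lift u v huv (x h) = u := by
  simp [lift, x]

@[simp]
theorem lift_y {S : Type*} [Ring S] [Algebra F S] (u v : S) (huv : v * u = u * v + aeval u h) :
    lift u v huv (y h) = v := by
  simp [lift, y]

@[elab_as_elim]
theorem induction {P : Ah h → Prop} (algebraMap : ∀ c : F, P (algebraMap F (Ah h) c))
    (x : P (x h)) (y : P (y h)) (add : ∀ a b, P a → P b → P (a + b))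
    (mul : ∀ a b, P a → P b → P (a * b)) (a : Ah h) : P a := by
  obtain ⟨a, rfl⟩ := RingQuot.mkAlgHom_surjective F (AhRel h) a
  induction a using FreeAlgebra.induction with
  | grade0 r => simpa using algebraMap r
  | grade1 i => fin_cases i <;> assumption
  | mul a b ha hb => simpa using mul _ _ ha hb
  | add a b ha hb => simpa using add _ _ ha hb

theorem hom_ext {S : Type*} [Ring S] [Algebra F S] {f g : Ah h →ₐ[F] S}
    (hx : f (x h) = g (x h)) (hy : f (y h) = g (y h)) : f = g := by
  refine AlgHom.ext fun a => ?_
  induction a using Ah.induction <;> simp_all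

theorem y_mul_aeval (f : F[X]) :
    y h * aeval (x h) f = aeval (x h) f * y h + aeval (x h) (h * derivative f) := by
  induction f using Polynomial.induction_on' with
  | add p q hp hq => simp only [map_add, mul_add, add_mul, hp, hq]; abel
  | monomial n c =>
    rw [← C_mul_X_pow_eq_monomial]
    induction n with
    | zero => simp [Algebra.commutes]
    | succ n ih =>
      have hX : derivative (C c * X ^ n * X) = derivative (C c * X ^ n) * X + C c * X ^ n := by
        rw [derivative_mul, derivative_X, mul_one]
      rw [pow_succ, ← mul_assoc, map_mul, ← mul_assoc, ih, hX, add_mul, aeval_X, mul_assoc,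
        y_mul_x, mul_add, mul_add, map_add, ← mul_assoc h, map_mul _ _ X, aeval_X,
        mul_comm h (C c * X ^ n), map_mul _ _ h]
      simp only [mul_assoc]
      abel

end Presentation

/-! ### Normal forms, degree in `y`, units. -/

section NormalForm

variable {F : Type*} [Field F] (h : F[X])

/-- The map `∑ f_j Y^j ↦ ∑ f_j(x) y^j`. -/
noncomputable def ofPoly : F[X][X] →ₗ[F] Ah h :=
  lsum fun j => (LinearMap.mulRight F (y h ^ j)).comp (aeval (x h)).toLinearMap

@[simp]
theorem ofPoly_monomial (j : ℕ) (f : F[X]) :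
    ofPoly h (monomial j f) = aeval (x h) f * y h ^ j := by
  simp [ofPoly, lsum_apply, sum_monomial_index]

@[simp]
theorem ofPoly_C (f : F[X]) : ofPoly h (C f) = aeval (x h) f := by
  rw [← monomial_zero_left, ofPoly_monomial, pow_zero, mul_one]

theorem ofPoly_C_mul (f : F[X]) (p : F[X][X]) :
    ofPoly h (C f * p) = aeval (x h) f * ofPoly h p := by
  induction p using Polynomial.induction_on' with
  | add p q hp hq => simp only [mul_add, map_add, hp, hq]
  | monomial n c => simp [C_mul_monomial, mul_assoc]

/-- The derivation `h d/dx` of `F[x]`, applied coefficientwise on `F[x][Y]`. -/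
noncomputable def coeffDeriv : F[X][X] →ₗ[F] F[X][X] :=
  lsum fun j => ((monomial j).restrictScalars F).comp
    ((LinearMap.mulLeft F h).comp (derivative.restrictScalars F))

@[simp]
theorem coeffDeriv_monomial (j : ℕ) (f : F[X]) :
    coeffDeriv h (monomial j f) = monomial j (h * derivative f) := by
  simp [coeffDeriv, lsum_apply, sum_monomial_index]

@[simp]
theorem coeff_coeffDeriv (p : F[X][X]) (n : ℕ) :
    (coeffDeriv h p).coeff n = h * derivative (p.coeff n) := by
  induction p using Polynomial.induction_on' with
  | add p q hp hq => simp [hp, hq, mul_add]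
  | monomial j f =>
    rw [coeffDeriv_monomial, coeff_monomial, coeff_monomial]
    split_ifs <;> simp

/-- Left multiplication by `y` in terms of normal forms. -/
noncomputable def yAct : F[X][X] →ₗ[F] F[X][X] := LinearMap.mulLeft F X + coeffDeriv h

theorem yAct_apply (p : F[X][X]) : yAct h p = X * p + coeffDeriv h p := rfl

theorem aeval_lmul (f : F[X]) :
    aeval (Algebra.lmul F F[X][X] (C X)) f = Algebra.lmul F F[X][X] (C f) := by
  rw [aeval_algHom_apply]
  congr 1
  have := aeval_algHom_apply (CAlgHom : F[X] →ₐ[F] F[X][X]) X f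
  simpa using this

/-- The left regular representation of `A_h` in terms of normal forms. -/
noncomputable def rep : Ah h →ₐ[F] Module.End F F[X][X] :=
  lift (Algebra.lmul F F[X][X] (C X)) (yAct h) <| by
    rw [aeval_lmul]
    ext1 p
    ext1 n
    cases n <;> simp [yAct_apply, coeff_X_mul, mul_add] <;> ring

@[simp]
theorem rep_aeval (f : F[X]) (p : F[X][X]) : rep h (aeval (x h) f) p = C f * p := by
  rw [← aeval_algHom_apply, rep, lift_x, aeval_lmul]
  rfl

@[simp]
theorem rep_y (p : F[X][X]) : rep h (y h) p = yAct h p := by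
  rw [rep, lift_y]

theorem y_mul_ofPoly (p : F[X][X]) : y h * ofPoly h p = ofPoly h (yAct h p) := by
  induction p using Polynomial.induction_on' with
  | add p q hp hq => simp only [mul_add, map_add, hp, hq]
  | monomial j f =>
    simp only [yAct_apply, X_mul_monomial, coeffDeriv_monomial, map_add, ofPoly_monomial,
      ← mul_assoc, y_mul_aeval, add_mul, pow_succ']

/-- `ofPoly` intertwines `rep` with left multiplication. Evaluating at `1` shows that `ofPoly`
inverts `toPoly`, so normal forms exist and `rep` is faithful. -/
theorem mul_ofPoly (a : Ah h) (p : F[X][X]) : a * ofPoly h p = ofPoly h (rep h a p) := by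
  induction a using Ah.induction generalizing p with
  | algebraMap c => simp [Algebra.algebraMap_eq_smul_one]
  | x =>
    have := rep_aeval h X p
    rw [aeval_X] at this
    rw [this, ofPoly_C_mul, aeval_X]
  | y => rw [rep_y, y_mul_ofPoly]
  | add a b ha hb => simp [add_mul, ha, hb]
  | mul a b ha hb => simp [mul_assoc, ha, hb]

variable {h}

/-- The coefficients of the normal form of an element of `A_h`. -/
noncomputable def toPoly : Ah h →ₗ[F] F[X][X] :=
  (LinearMap.applyₗ (1 : F[X][X])).comp (rep h).toLinearMap

theorem toPoly_apply (a : Ah h) : toPoly a = rep h a 1 := rfl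

@[simp]
theorem ofPoly_toPoly (a : Ah h) : ofPoly h (toPoly a) = a := by
  rw [toPoly_apply, ← mul_ofPoly, ← C_1, ofPoly_C, map_one, mul_one]

theorem toPoly_mul (a b : Ah h) : toPoly (a * b) = rep h a (toPoly b) := by
  simp [toPoly_apply]

@[simp]
theorem toPoly_aeval (f : F[X]) : toPoly (aeval (x h) f) = C f := by
  simp [toPoly_apply]

theorem aeval_x_injective : Function.Injective (aeval (x h) : F[X] →ₐ[F] Ah h) := fun f g hfg =>
  C_injective (by simpa using congrArg toPoly hfg)

theorem toPoly_injective : Function.Injective (toPoly : Ah h →ₗ[F] F[X][X]) :=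
  Function.LeftInverse.injective ofPoly_toPoly

theorem toPoly_ne_zero {a : Ah h} (ha : a ≠ 0) : toPoly a ≠ 0 := fun h0 =>
  ha (toPoly_injective (by rw [h0, map_zero]))

theorem natDegree_coeffDeriv_le (p : F[X][X]) : (coeffDeriv h p).natDegree ≤ p.natDegree := by
  rw [natDegree_le_iff_coeff_eq_zero]
  intro n hn
  rw [coeff_coeffDeriv, coeff_eq_zero_of_natDegree_lt hn, map_zero, mul_zero]

/-- The coefficientwise derivation does not raise the degree, so only multiplication by `X` reaches
the top coefficient. -/
theorem yAct_pow_spec (j : ℕ) {p : F[X][X]} {n : ℕ} (hp : p.natDegree ≤ n) :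
    ((yAct h ^ j) p).natDegree ≤ j + n ∧ ((yAct h ^ j) p).coeff (j + n) = p.coeff n := by
  induction j with
  | zero => simpa using hp
  | succ j ih =>
    obtain ⟨h1, h2⟩ := ih
    rw [pow_succ', Module.End.mul_apply, yAct_apply]
    have hD := (natDegree_coeffDeriv_le (h := h) ((yAct h ^ j) p)).trans h1
    constructor
    · refine natDegree_add_le_of_degree_le ?_ (by omega)
      exact natDegree_mul_le_of_le natDegree_X_le h1 |>.trans (by omega)
    · rw [coeff_add, coeff_eq_zero_of_natDegree_lt (p := coeffDeriv h _) (by omega), add_zero,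
        show j + 1 + n = (j + n) + 1 by omega, coeff_X_mul, h2]

theorem rep_ofPoly (p q : F[X][X]) :
    rep h (ofPoly h p) q = ∑ j ∈ Finset.range (p.natDegree + 1), C (p.coeff j) * (yAct h ^ j) q := by
  conv_lhs => rw [p.as_sum_range]
  simp only [map_sum, ofPoly_monomial, map_mul, map_pow, LinearMap.sum_apply, Module.End.mul_apply,
    rep_aeval]
  simp [rep]

theorem natDegree_toPoly_mul_le (a b : Ah h) :
    (toPoly (a * b)).natDegree ≤ (toPoly a).natDegree + (toPoly b).natDegree := by
  rw [toPoly_mul, ← ofPoly_toPoly a, rep_ofPoly, ofPoly_toPoly]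
  refine natDegree_sum_le_of_forall_le _ _ fun j hj => ?_
  refine (natDegree_C_mul_le _ _).trans ((yAct_pow_spec j le_rfl).1.trans ?_)
  have := Finset.mem_range.1 hj
  omega

theorem coeff_toPoly_mul (a b : Ah h) :
    (toPoly (a * b)).coeff ((toPoly a).natDegree + (toPoly b).natDegree) =
      (toPoly a).leadingCoeff * (toPoly b).leadingCoeff := by
  rw [toPoly_mul, ← ofPoly_toPoly a, rep_ofPoly, ofPoly_toPoly, finsetSum_coeff,
    Finset.sum_range_succ, Finset.sum_eq_zero, zero_add, coeff_C_mul,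
    (yAct_pow_spec _ le_rfl).2]
  · rfl
  · intro j hj
    rw [coeff_C_mul, coeff_eq_zero_of_natDegree_lt (p := (yAct h ^ j) _), mul_zero]
    have := Finset.mem_range.1 hj
    exact (yAct_pow_spec j le_rfl).1.trans_lt (by omega)

theorem natDegree_toPoly_mul {a b : Ah h} (ha : a ≠ 0) (hb : b ≠ 0) :
    (toPoly (a * b)).natDegree = (toPoly a).natDegree + (toPoly b).natDegree := by
  refine (natDegree_toPoly_mul_le a b).antisymm (le_natDegree_of_ne_zero ?_)
  rw [coeff_toPoly_mul]
  exact mul_ne_zero (leadingCoeff_ne_zero.2 (toPoly_ne_zero ha))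
    (leadingCoeff_ne_zero.2 (toPoly_ne_zero hb))

theorem leadingCoeff_toPoly_mul (a b : Ah h) :
    (toPoly (a * b)).leadingCoeff = (toPoly a).leadingCoeff * (toPoly b).leadingCoeff := by
  rcases eq_or_ne a 0 with rfl | ha
  · simp
  rcases eq_or_ne b 0 with rfl | hb
  · simp
  rw [← coeff_toPoly_mul, leadingCoeff, natDegree_toPoly_mul ha hb]

instance : Nontrivial (Ah h) :=
  (aeval_x_injective (h := h)).nontrivial

instance : NoZeroDivisors (Ah h) where
  eq_zero_or_eq_zero_of_mul_eq_zero {a b} hab := by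
    by_contra! hc
    have := leadingCoeff_toPoly_mul a b
    rw [hab, map_zero, leadingCoeff_zero] at this
    exact mul_ne_zero (leadingCoeff_ne_zero.2 (toPoly_ne_zero hc.1))
      (leadingCoeff_ne_zero.2 (toPoly_ne_zero hc.2)) this.symm

theorem exists_eq_aeval_of_natDegree {a : Ah h} (ha : (toPoly a).natDegree = 0) :
    ∃ f : F[X], a = aeval (x h) f := by
  refine ⟨(toPoly a).coeff 0, toPoly_injective ?_⟩
  rw [toPoly_aeval]
  exact eq_C_of_natDegree_eq_zero ha

theorem exists_eq_algebraMap_of_mul_eq_one {a b : Ah h} (hab : a * b = 1) :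
    ∃ c : F, c ≠ 0 ∧ a = algebraMap F (Ah h) c := by
  have ha : a ≠ 0 := left_ne_zero_of_mul_eq_one hab
  have hb : b ≠ 0 := right_ne_zero_of_mul_eq_one hab
  have h1 : toPoly (1 : Ah h) = C 1 := by
    simpa using toPoly_aeval (h := h) 1
  have hd := natDegree_toPoly_mul ha hb
  rw [hab, h1, natDegree_C] at hd
  obtain ⟨f, rfl⟩ := exists_eq_aeval_of_natDegree (a := a) (by omega)
  obtain ⟨g, rfl⟩ := exists_eq_aeval_of_natDegree (a := b) (by omega)
  rw [← map_mul, ← map_one (aeval (x h) : F[X] →ₐ[F] Ah h)] at hab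
  obtain ⟨c, hc, rfl⟩ := Polynomial.isUnit_iff.1 (IsUnit.of_mul_eq_one _ (aeval_x_injective hab))
  exact ⟨c, hc.ne_zero, by simp⟩

/-- Leading coefficients multiply in the commutative ring `F[x]`, so `a * b` and `b * a` have the
same one. -/
theorem eq_one_of_mul_eq_smul_mul {a b : Ah h} (ha : a ≠ 0) (hb : b ≠ 0) {c : F}
    (hab : a * b = c • (b * a)) : c = 1 := by
  have h1 := congrArg (fun z => (toPoly z).leadingCoeff) hab
  simp only [map_smul] at h1
  rw [← algebraMap_smul F[X] c, smul_eq_C_mul, leadingCoeff_mul, leadingCoeff_C,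
    leadingCoeff_toPoly_mul, leadingCoeff_toPoly_mul, mul_comm (toPoly b).leadingCoeff] at h1
  have h2 := mul_ne_zero (leadingCoeff_ne_zero.2 (toPoly_ne_zero ha))
    (leadingCoeff_ne_zero.2 (toPoly_ne_zero hb))
  have h3 := (right_eq_mul₀ h2).1 h1
  exact C_injective (by simpa using h3)

end NormalForm

/-! ### Commutative quotient and commutators. -/

section CommQuotient

variable {F : Type*} [Field F] (h : F[X])

/-- The map onto the largest commutative quotient `(F[x]/(h))[Y]` of `A_h`. -/
noncomputable def toComm : Ah h →ₐ[F] (AdjoinRoot h)[X] :=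
  lift (C (AdjoinRoot.root h)) X <| by
    have : aeval (C (AdjoinRoot.root h)) h = CAlgHom (R := F) (aeval (AdjoinRoot.root h) h) :=
      aeval_algHom_apply (CAlgHom : AdjoinRoot h →ₐ[F] (AdjoinRoot h)[X]) _ _
    rw [this, AdjoinRoot.aeval_eq, AdjoinRoot.mk_self, map_zero, add_zero, X_mul]

@[simp]
theorem toComm_y : toComm h (y h) = X := lift_y _ _ _

theorem toComm_aeval (f : F[X]) : toComm h (aeval (x h) f) = C (AdjoinRoot.mk h f) := by
  rw [← aeval_algHom_apply, toComm, lift_x, ← AdjoinRoot.aeval_eq]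
  exact aeval_algHom_apply (CAlgHom : AdjoinRoot h →ₐ[F] (AdjoinRoot h)[X]) _ _

theorem toComm_ofPoly (p : F[X][X]) : toComm h (ofPoly h p) = p.map (AdjoinRoot.mk h) := by
  induction p using Polynomial.induction_on' with
  | add p q hp hq => simp [hp, hq]
  | monomial j f =>
    rw [ofPoly_monomial, map_mul, map_pow, toComm_y, toComm_aeval, map_monomial,
      C_mul_X_pow_eq_monomial]

variable {h}

theorem exists_eq_mul_of_toComm_eq_zero {a : Ah h} (ha : toComm h a = 0) :
    ∃ b, a = aeval (x h) h * b := by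
  rw [← ofPoly_toPoly a, toComm_ofPoly] at ha
  have : C h ∣ toPoly a := by
    rw [C_dvd_iff_dvd_coeff]
    intro i
    rw [← AdjoinRoot.mk_eq_zero, ← coeff_map, ha, coeff_zero]
  obtain ⟨p, hp⟩ := this
  exact ⟨ofPoly h p, by rw [← ofPoly_C_mul, ← hp, ofPoly_toPoly]⟩

theorem exists_commutator_eq_mul (a b : Ah h) : ∃ c, a * b - b * a = aeval (x h) h * c :=
  exists_eq_mul_of_toComm_eq_zero (by rw [map_sub, map_mul, map_mul, mul_comm, sub_self])

end CommQuotient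

end Ah

/-! ### Generalized Weyl algebras and their action on sequences. -/

namespace GWA

variable {R : Type*} [CommRing R] (σ : R ≃+* R) (a : R)

/-- The structure map `R → R(σ, a)`. -/
def coeff : R →+* GWA σ a where
  toFun b := RingQuot.mkRingHom (GWARel σ a) (FreeAlgebra.ι ℤ (GWAGen.coeff b))
  map_one' := by rw [RingQuot.mkRingHom_rel GWARel.coeff_one, map_one]
  map_mul' b c := by rw [RingQuot.mkRingHom_rel (GWARel.coeff_mul b c), map_mul]
  map_zero' := by
    have := RingQuot.mkRingHom_rel (GWARel.coeff_add (σ := σ) (a := a) 0 0)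
    rw [add_zero, map_add] at this
    exact left_eq_add.1 this
  map_add' b c := by rw [RingQuot.mkRingHom_rel (GWARel.coeff_add b c), map_add]

/-- The generator `x` of `R(σ, a)`. -/
def x : GWA σ a := RingQuot.mkRingHom (GWARel σ a) (FreeAlgebra.ι ℤ GWAGen.x)

/-- The generator `y` of `R(σ, a)`. -/
def y : GWA σ a := RingQuot.mkRingHom (GWARel σ a) (FreeAlgebra.ι ℤ GWAGen.y)

theorem y_mul_coeff (b : R) : y σ a * coeff σ a b = coeff σ a (σ b) * y σ a := by
  have := RingQuot.mkRingHom_rel (GWARel.y_coeff (σ := σ) (a := a) b)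
  rwa [map_mul, map_mul] at this

theorem coeff_mul_x (b : R) : coeff σ a b * x σ a = x σ a * coeff σ a (σ b) := by
  have := RingQuot.mkRingHom_rel (GWARel.coeff_x (σ := σ) (a := a) b)
  rwa [map_mul, map_mul] at this

theorem x_mul_y : x σ a * y σ a = coeff σ a a := by
  have := RingQuot.mkRingHom_rel (GWARel.x_y (σ := σ) (a := a))
  rwa [map_mul] at this

theorem y_mul_x : y σ a * x σ a = coeff σ a (σ a) := by
  have := RingQuot.mkRingHom_rel (GWARel.y_x (σ := σ) (a := a))
  rwa [map_mul] at this

variable {σ a}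

@[elab_as_elim]
theorem induction {P : GWA σ a → Prop} (coeff : ∀ b, P (coeff σ a b)) (x : P (x σ a))
    (y : P (y σ a)) (add : ∀ b c, P b → P c → P (b + c)) (mul : ∀ b c, P b → P c → P (b * c))
    (b : GWA σ a) : P b := by
  obtain ⟨b, rfl⟩ := RingQuot.mkRingHom_surjective (GWARel σ a) b
  induction b using FreeAlgebra.induction with
  | grade0 n => simpa using coeff n
  | grade1 i => cases i <;> solve_by_elim
  | mul b c hb hc => simpa using mul _ _ hb hc
  | add b c hb hc => simpa using add _ _ hb hc

/-- The universal property of `R(σ, a)`. -/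
noncomputable def lift {S : Type*} [Ring S] (f : R →+* S) (u v : S) (hv : ∀ b, v * f b = f (σ b) * v)
    (hu : ∀ b, f b * u = u * f (σ b)) (huv : u * v = f a) (hvu : v * u = f (σ a)) :
    GWA σ a →+* S :=
  RingQuot.lift ⟨(FreeAlgebra.lift ℤ (GWAGen.rec f u v : GWAGen R → S)).toRingHom, by
    rintro _ _ (_ | _) <;> simp [*]⟩

section Lift

variable {S : Type*} [Ring S] (f : R →+* S) (u v : S) (hv : ∀ b, v * f b = f (σ b) * v)
  (hu : ∀ b, f b * u = u * f (σ b)) (huv : u * v = f a) (hvu : v * u = f (σ a))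

@[simp]
theorem lift_coeff (b : R) : lift f u v hv hu huv hvu (coeff σ a b) = f b := by
  simp [lift, coeff]

@[simp]
theorem lift_x : lift f u v hv hu huv hvu (x σ a) = u := by
  simp [lift, x]

@[simp]
theorem lift_y : lift f u v hv hu huv hvu (y σ a) = v := by
  simp [lift, y]

end Lift

section Representation

variable (σ)

/-- `R` acts on sequences indexed by `ℤ` through the powers of `σ`. -/
def coeffAct : R →+* AddMonoid.End (ℤ → R) where
  toFun b :=
    { toFun := fun m i => ((σ : RingAut R) ^ i) b * m i
      map_zero' := by ext; simp
      map_add' := fun m n => by ext; simp [mul_add] }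
  map_one' := by
    ext m i
    change ((σ : RingAut R) ^ i) 1 * m i = m i
    rw [map_one, one_mul]
  map_mul' b c := by
    ext m i
    change ((σ : RingAut R) ^ i) (b * c) * m i =
      ((σ : RingAut R) ^ i) b * (((σ : RingAut R) ^ i) c * m i)
    rw [map_mul, mul_assoc]
  map_zero' := by
    ext m i
    change ((σ : RingAut R) ^ i) 0 * m i = 0
    rw [map_zero, zero_mul]
  map_add' b c := by
    ext m i
    change ((σ : RingAut R) ^ i) (b + c) * m i =
      ((σ : RingAut R) ^ i) b * m i + ((σ : RingAut R) ^ i) c * m i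
    rw [map_add, add_mul]

/-- The action of `x` on sequences. -/
def xAct (p : R) : AddMonoid.End (ℤ → R) where
  toFun m i := ((σ : RingAut R) ^ i) p * m (i - 1)
  map_zero' := by ext; simp
  map_add' m n := by ext; simp [mul_add]

/-- The action of `y` on sequences. -/
def yAct (q : R) : AddMonoid.End (ℤ → R) where
  toFun m i := ((σ : RingAut R) ^ (i + 1)) q * m (i + 1)
  map_zero' := by ext; simp
  map_add' m n := by ext; simp [mul_add]

theorem coeffAct_apply (b : R) (m : ℤ → R) (i : ℤ) :
    coeffAct σ b m i = ((σ : RingAut R) ^ i) b * m i := rfl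

theorem xAct_apply (p : R) (m : ℤ → R) (i : ℤ) :
    xAct σ p m i = ((σ : RingAut R) ^ i) p * m (i - 1) := rfl

theorem yAct_apply (q : R) (m : ℤ → R) (i : ℤ) :
    yAct σ q m i = ((σ : RingAut R) ^ (i + 1)) q * m (i + 1) := rfl

theorem zpow_apply_map (i : ℤ) (b : R) :
    ((σ : RingAut R) ^ i) (σ b) = ((σ : RingAut R) ^ (i + 1)) b := by
  rw [zpow_add_one]; rfl

/-- A factorization `a = p q` gives a representation of `R(σ, a)` on sequences. -/
noncomputable def rep (p q : R) : GWA σ (p * q) →+* AddMonoid.End (ℤ → R) :=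
  lift (coeffAct σ) (xAct σ p) (yAct σ q)
    (fun b => by
      ext m i
      simp only [AddMonoid.End.coe_mul, Function.comp_apply, coeffAct_apply, yAct_apply, zpow_apply_map]
      ring)
    (fun b => by
      ext m i
      simp only [AddMonoid.End.coe_mul, Function.comp_apply, coeffAct_apply, xAct_apply, zpow_apply_map,
        sub_add_cancel]
      ring)
    (by
      ext m i
      simp only [AddMonoid.End.coe_mul, Function.comp_apply, coeffAct_apply, xAct_apply, yAct_apply, sub_add_cancel,
        map_mul])
    (by
      ext m i
      simp only [AddMonoid.End.coe_mul, Function.comp_apply, coeffAct_apply, xAct_apply, yAct_apply,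
        add_sub_cancel_right, map_mul, zpow_apply_map]
      ring)

variable (a)

theorem coeff_injective : Function.Injective (coeff σ a) := by
  rw [injective_iff_map_eq_zero]
  intro b hb
  obtain ⟨p, q, rfl⟩ : ∃ p q, a = p * q := ⟨a, 1, (mul_one a).symm⟩
  have h1 := congrArg (rep σ p q) hb
  rw [rep, lift_coeff, map_zero] at h1
  simpa [coeffAct_apply] using congrFun (DFunLike.congr_fun h1 1) 0

theorem x_ne_zero [Nontrivial R] : x σ a ≠ 0 := by
  intro hx
  -- With `p = 1` the generator `x` acts as a pure shift, nonzero even when `a = 0`.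
  obtain ⟨p, q, rfl, rfl⟩ : ∃ p q, a = p * q ∧ p = 1 := ⟨1, a, (one_mul a).symm, rfl⟩
  have h1 := congrArg (rep σ 1 q) hx
  rw [rep, lift_x, map_zero] at h1
  simpa [xAct_apply] using congrFun (DFunLike.congr_fun h1 1) 0

theorem y_ne_zero [Nontrivial R] : y σ a ≠ 0 := by
  intro hy
  obtain ⟨p, q, rfl, rfl⟩ : ∃ p q, a = p * q ∧ q = 1 := ⟨a, 1, (mul_one a).symm, rfl⟩
  have h1 := congrArg (rep σ p 1) hy
  rw [rep, lift_y, map_zero] at h1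
  simpa [yAct_apply] using congrFun (DFunLike.congr_fun h1 1) 0

end Representation

/-- If `σ` is the identity then `R(σ, a)` is commutative. -/
theorem mul_comm_of_forall_eq (hσ : ∀ b, σ b = b) (b c : GWA σ a) : b * c = c * b := by
  have key : ∀ z : GWA σ a, (∀ r, Commute (coeff σ a r) z) → Commute (x σ a) z →
      Commute (y σ a) z → ∀ w, Commute w z := by
    intro z h1 h2 h3 w
    induction w using GWA.induction with
    | coeff r => exact h1 r
    | x => exact h2
    | y => exact h3
    | add _ _ h h' => exact h.add_left h'
    | mul _ _ h h' => exact h.mul_left h'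
  have hx : ∀ r, Commute (coeff σ a r) (x σ a) := fun r => by
    have := coeff_mul_x σ a r
    rwa [hσ] at this
  have hy : ∀ r, Commute (y σ a) (coeff σ a r) := fun r => by
    have := y_mul_coeff σ a r
    rwa [hσ] at this
  have hxy : Commute (x σ a) (y σ a) := by
    have := y_mul_x σ a
    rw [hσ, ← x_mul_y] at this
    exact this.symm
  refine (key b (fun r => ?_) ?_ ?_ c).symm
  · exact (key _ (fun s => (Commute.all s r).map (coeff σ a)) (hx r).symm (hy r) b).symm
  · exact (key _ hx (Commute.refl _) hxy.symm b).symm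
  · exact (key _ (fun r => (hy r).symm) hxy (Commute.refl _) b).symm

/-- A ring homomorphism killing `x` and `y` has the same range as its restriction to `R`. -/
theorem exists_map_coeff_eq {S : Type*} [Ring S] (f : GWA σ a →+* S) (hx : f (x σ a) = 0)
    (hy : f (y σ a) = 0) (b : GWA σ a) : ∃ r, f (coeff σ a r) = f b := by
  induction b using GWA.induction with
  | coeff r => exact ⟨r, rfl⟩
  | x => exact ⟨0, by simp [hx]⟩
  | y => exact ⟨0, by simp [hy]⟩
  | add _ _ h h' =>
    obtain ⟨r, hr⟩ := h
    obtain ⟨s, hs⟩ := h'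
    exact ⟨r + s, by simp [hr, hs]⟩
  | mul _ _ h h' =>
    obtain ⟨r, hr⟩ := h
    obtain ⟨s, hs⟩ := h'
    exact ⟨r * s, by simp [hr, hs]⟩

end GWA

/-! ### Isomorphisms between the algebras `A_h`. -/

theorem Polynomial.exists_eq_of_comp_eq_X {F : Type*} [Field F] {p q : F[X]} (hpq : p.comp q = X) :
    ∃ α β : F, α ≠ 0 ∧ q = C α * X + C β := by
  have h1 := congrArg natDegree hpq
  rw [natDegree_comp, natDegree_X] at h1
  have h2 := Nat.eq_one_of_mul_eq_one_left h1
  refine ⟨q.coeff 1, q.coeff 0, ?_, eq_X_add_C_of_natDegree_le_one h2.le⟩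
  rw [← h2]
  exact leadingCoeff_ne_zero.2 (ne_zero_of_natDegree_gt (n := 0) (by omega))

namespace Ah

variable {F : Type*} [Field F] {h g : F[X]}

/-- An isomorphism maps `h` to an element divisible by `g`. -/
theorem exists_apply_eq_mul (φ : Ah h ≃ₐ[F] Ah g) :
    ∃ u, φ (aeval (x h) h) = aeval (x g) g * u := by
  have h1 : aeval (x h) h = y h * x h - x h * y h := by rw [y_mul_x, add_sub_cancel_left]
  rw [h1, map_sub, map_mul, map_mul]
  exact exists_commutator_eq_mul _ _

theorem exists_apply_eq_smul (φ : Ah h ≃ₐ[F] Ah g) :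
    ∃ c : F, c ≠ 0 ∧ φ (aeval (x h) h) = aeval (x g) (C c * g) := by
  obtain ⟨u, hu⟩ := exists_apply_eq_mul φ
  obtain ⟨v, hv⟩ := exists_apply_eq_mul φ.symm
  rcases eq_or_ne (aeval (x h) h) 0 with h0 | h0
  · rw [h0, map_zero] at hu ⊢
    have hg : aeval (x g) g = 0 := φ.symm.injective (by rw [hv, h0, zero_mul, map_zero])
    exact ⟨1, one_ne_zero, by simp [hg]⟩
  · have h1 : v * φ.symm u = 1 := by
      apply mul_left_cancel₀ h0
      rw [← mul_assoc, ← hv, ← map_mul, ← hu, φ.symm_apply_apply, mul_one]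
    have h2 : φ.symm u * v = 1 := by
      have hv0 : v ≠ 0 := left_ne_zero_of_mul_eq_one h1
      apply mul_left_cancel₀ hv0
      rw [← mul_assoc, h1, one_mul, mul_one]
    obtain ⟨c, hc, hcu⟩ := exists_eq_algebraMap_of_mul_eq_one h2
    refine ⟨c, hc, ?_⟩
    have hu' : u = algebraMap F _ c := by
      rw [← φ.apply_symm_apply u, hcu, AlgEquiv.commutes]
    rw [hu, hu', map_mul, aeval_C, Algebra.commutes]

/-- If `h` is not constant, an isomorphism maps `x` into `F[x]`. -/
theorem exists_apply_x_eq (φ : Ah h ≃ₐ[F] Ah g) (hh : ∀ c : F, h ≠ C c) :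
    ∃ p : F[X], φ (x h) = aeval (x g) p := by
  apply exists_eq_aeval_of_natDegree
  obtain ⟨c, -, hcg⟩ := exists_apply_eq_smul φ
  -- `h.divX * X = h - h(0)` is a nonzero multiple of `x`, and its image has degree `0` in `y`;
  -- hence so does each factor.
  have hd : h.divX ≠ 0 := fun h0 => hh (h.coeff 0) (by
    conv_lhs => rw [← h.divX_mul_X_add, h0, zero_mul, zero_add])
  have hX : x h ≠ 0 := fun h0 => X_ne_zero (aeval_x_injective (h := h) (by simpa using h0))
  have hD : aeval (x h) h.divX ≠ 0 := fun h0 =>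
    hd (aeval_x_injective (h := h) (by simpa using h0))
  have h1 : φ (aeval (x h) h.divX) * φ (x h) = aeval (x g) (C c * g - C (h.coeff 0)) := by
    have h2 := congrArg (fun q => φ (aeval (x h) q)) h.divX_mul_X_add
    simp only [map_add, map_mul, aeval_X, aeval_C, AlgEquiv.commutes, hcg] at h2
    rw [map_sub, aeval_C, map_mul, aeval_C, ← h2, add_sub_cancel_right]
  have h2 := natDegree_toPoly_mul ((map_ne_zero_iff φ φ.injective).2 hD)
    ((map_ne_zero_iff φ φ.injective).2 hX)
  rw [h1, toPoly_aeval, natDegree_C] at h2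
  omega

theorem exists_eq_comp (φ : Ah h ≃ₐ[F] Ah g) :
    ∃ α β ν : F, α * ν ≠ 0 ∧ g = C ν * h.comp (C α * X + C β) := by
  obtain ⟨c, hc, hcg⟩ := exists_apply_eq_smul φ
  have hcancel : ∀ q : F[X], C c * g = q → g = C c⁻¹ * q := by
    rintro _ rfl
    rw [← mul_assoc, ← C_mul, inv_mul_cancel₀ hc, C_1, one_mul]
  by_cases hh : ∃ k : F, h = C k
  · obtain ⟨k, rfl⟩ := hh
    refine ⟨1, 0, c⁻¹, by simpa using hc, hcancel _ (aeval_x_injective (h := g) ?_)⟩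
    rw [← hcg]
    simp
  push Not at hh
  obtain ⟨p, hp⟩ := exists_apply_x_eq φ hh
  have hcomp : ∀ q : F[X], φ (aeval (x h) q) = aeval (x g) (q.comp p) := fun q => by
    rw [aeval_comp, ← hp]
    exact (aeval_algHom_apply φ.toAlgHom _ _).symm
  have hgc : C c * g = h.comp p := aeval_x_injective (by rw [← hcg, hcomp])
  have hg : ∀ k : F, g ≠ C k := by
    intro k hk
    apply hh (c * k)
    apply aeval_x_injective
    apply φ.injective
    rw [hcg, show C c * g = C (c * k) by rw [hk, C_mul]]
    simp
  obtain ⟨q, hq⟩ := exists_apply_x_eq φ.symm hg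
  have hqp : q.comp p = X := aeval_x_injective (h := g) (by
    rw [← hcomp, ← hq, φ.apply_symm_apply, aeval_X])
  obtain ⟨α, β, hα, rfl⟩ := exists_eq_of_comp_eq_X hqp
  exact ⟨α, β, c⁻¹, mul_ne_zero hα (inv_ne_zero hc), hcancel _ hgc⟩

/-- The affine change of variable `x ↦ α x + β`, `y ↦ (α ν)⁻¹ y` of `A_h`. -/
noncomputable def affineHom (α β ν : F) (hαν : α * ν ≠ 0)
    (hg : g = C ν * h.comp (C α * X + C β)) : Ah h →ₐ[F] Ah g :=
  lift (aeval (x g) (C α * X + C β)) ((α * ν)⁻¹ • y g) <| by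
    -- The derivative of the substitution contributes `α` and `g` contributes `ν`; rescaling `y` by
    -- `(α ν)⁻¹` cancels both.
    have hc : aeval (x g) (g * derivative (C α * X + C β)) =
        (α * ν) • aeval (aeval (x g) (C α * X + C β)) h := by
      rw [← aeval_comp, ← map_smul, smul_eq_C_mul]
      have hd : derivative (C α * X + C β) = C α := by simp
      refine congrArg _ ((congrArg (· * _) hg).trans ?_)
      rw [hd, C_mul]
      ring
    rw [smul_mul_assoc, y_mul_aeval, hc, smul_add, inv_smul_smul₀ hαν, mul_smul_comm]

theorem nonempty_algEquiv (α β ν : F) (hαν : α * ν ≠ 0)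
    (hg : g = C ν * h.comp (C α * X + C β)) : Nonempty (Ah h ≃ₐ[F] Ah g) := by
  have hα : α ≠ 0 := left_ne_zero_of_mul hαν
  have hν : ν ≠ 0 := right_ne_zero_of_mul hαν
  have hαν' : α⁻¹ * ν⁻¹ ≠ 0 := mul_ne_zero (inv_ne_zero hα) (inv_ne_zero hν)
  have e1 : (C α * X + C β : F[X]).comp (C α⁻¹ * X + C (-(α⁻¹ * β))) = X := by
    simp only [add_comp, mul_comp, C_comp, X_comp, mul_add, ← mul_assoc, ← C_mul, add_assoc,
      ← C_add]
    rw [mul_inv_cancel₀ hα, mul_neg, ← mul_assoc, mul_inv_cancel₀ hα]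
    simp
  have e2 : (C α⁻¹ * X + C (-(α⁻¹ * β)) : F[X]).comp (C α * X + C β) = X := by
    simp only [add_comp, mul_comp, C_comp, X_comp, mul_add, ← mul_assoc, ← C_mul, add_assoc,
      ← C_add]
    rw [inv_mul_cancel₀ hα]
    simp
  have hh : h = C ν⁻¹ * g.comp (C α⁻¹ * X + C (-(α⁻¹ * β))) := by
    rw [hg, mul_comp, comp_assoc, e1, comp_X, C_comp, ← mul_assoc, ← C_mul, inv_mul_cancel₀ hν,
      C_1, one_mul]
  refine ⟨AlgEquiv.ofAlgHom (affineHom α β ν hαν hg) (affineHom _ _ _ hαν' hh)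
    (hom_ext ?_ ?_) (hom_ext ?_ ?_)⟩
  · rw [AlgHom.comp_apply, affineHom, affineHom, lift_x, ← aeval_algHom_apply, lift_x,
      ← aeval_comp, e2, aeval_X, AlgHom.id_apply]
  · rw [AlgHom.comp_apply, affineHom, affineHom, lift_y, map_smul, lift_y, smul_smul,
      ← mul_inv, AlgHom.id_apply]
    rw [show α⁻¹ * ν⁻¹ * (α * ν) = 1 by field_simp, inv_one, one_smul]
  · rw [AlgHom.comp_apply, affineHom, affineHom, lift_x, ← aeval_algHom_apply, lift_x,
      ← aeval_comp, e1, aeval_X, AlgHom.id_apply]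
  · rw [AlgHom.comp_apply, affineHom, affineHom, lift_y, map_smul, lift_y, smul_smul,
      ← mul_inv, AlgHom.id_apply]
    rw [show α * ν * (α⁻¹ * ν⁻¹) = 1 by field_simp, inv_one, one_smul]

theorem nonempty_algEquiv_iff : Nonempty (Ah h ≃ₐ[F] Ah g) ↔
    ∃ α β ν : F, α * ν ≠ 0 ∧ g = C ν * h.comp (C α * X + C β) :=
  ⟨fun ⟨φ⟩ => exists_eq_comp φ, fun ⟨α, β, ν, hαν, hg⟩ => nonempty_algEquiv α β ν hαν hg⟩

end Ah

/-! ### Comparison with generalized Weyl algebras. -/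

theorem Polynomial.exists_pow_sub_pow_succ_mul_mem {F : Type*} [Field F] {a : F[X]} (ha : a ≠ 0)
    (p : F[X]) : ∃ (n : ℕ) (r : F[X]), a ∣ p ^ (n + 1) * r - p ^ n := by
  have : Module.Finite F (AdjoinRoot a) := (AdjoinRoot.powerBasis ha).finite
  have : IsArtinianRing (AdjoinRoot a) := IsArtinianRing.of_finite F _
  -- The ideals generated by the powers of `p` in `F[x]/(a)` stabilize.
  obtain ⟨n, r, hr⟩ := IsArtinian.exists_pow_succ_smul_dvd (AdjoinRoot.mk a p) (1 : AdjoinRoot a)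
  obtain ⟨r, rfl⟩ := AdjoinRoot.mk_surjective r
  refine ⟨n, r, ?_⟩
  rw [← AdjoinRoot.mk_eq_mk, map_mul, map_pow, map_pow]
  simpa using hr

/-- A ring homomorphism from `F[X]` to a polynomial ring that kills a nonzero polynomial does not
take the value `X`. -/
theorem Polynomial.map_ne_X_of_map_eq_zero {F K : Type*} [Field F] [CommRing K] [Nontrivial K]
    (f : F[X] →+* K[X]) {a : F[X]} (ha : a ≠ 0) (hfa : f a = 0) (p : F[X]) : f p ≠ X := by
  intro hp
  obtain ⟨n, r, s, hs⟩ := exists_pow_sub_pow_succ_mul_mem ha p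
  have h1 := congrArg f hs
  rw [map_sub, map_mul, map_mul, map_pow, map_pow, hfa, zero_mul, hp, sub_eq_zero] at h1
  have h2 := congrArg (coeff · n) h1
  simp only [coeff_X_pow_self] at h2
  rw [coeff_X_pow_mul', if_neg (by omega)] at h2
  exact zero_ne_one h2

theorem Polynomial.ringEquiv_apply_eq_comp {R : Type*} [CommRing R] (σ : R[X] ≃+* R[X])
    (hσ : ∀ c, σ (C c) = C c) (q : R[X]) : σ q = q.comp (σ X) := by
  have : (σ : R[X] →+* R[X]) = compRingHom (σ X) :=
    ringHom_ext (by simpa using hσ) (by simp)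
  exact RingHom.congr_fun this q

namespace Ah

variable {F : Type*} [Field F] {h : F[X]} {σ : F[X] ≃+* F[X]} {a : F[X]}

theorem exists_symm_coeff_C_eq (φ : Ah h ≃+* GWA σ a) {c : F} (hc : c ≠ 0) :
    ∃ k : F, φ.symm (GWA.coeff σ a (C c)) = algebraMap F (Ah h) k := by
  have h1 : φ.symm (GWA.coeff σ a (C c)) * φ.symm (GWA.coeff σ a (C c⁻¹)) = 1 := by
    rw [← map_mul, ← map_mul, ← C_mul, mul_inv_cancel₀ hc, C_1, map_one, map_one]
  obtain ⟨k, -, hk⟩ := exists_eq_algebraMap_of_mul_eq_one h1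
  exact ⟨k, hk⟩

theorem gwa_ne_zero (φ : Ah h ≃+* GWA σ a) : a ≠ 0 := by
  rintro rfl
  have h1 := congrArg φ.symm (GWA.x_mul_y σ 0)
  rw [map_zero, map_mul, map_zero, mul_eq_zero] at h1
  rcases h1 with h1 | h1
  · exact GWA.x_ne_zero σ 0 ((map_eq_zero_iff φ.symm φ.symm.injective).1 h1)
  · exact GWA.y_ne_zero σ 0 ((map_eq_zero_iff φ.symm φ.symm.injective).1 h1)

theorem symm_y_ne_zero (φ : Ah h ≃+* GWA σ a) : φ.symm (GWA.y σ a) ≠ 0 :=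
  (map_ne_zero_iff φ.symm φ.symm.injective).2 (GWA.y_ne_zero σ a)

/-- A nonzero constant is a unit, hence a central scalar in `A_h`; cancelling `y` in `y c = σ(c) y`
gives the claim. This makes `σ` a substitution although it is only assumed to be a ring
automorphism. -/
theorem gwa_apply_C (φ : Ah h ≃+* GWA σ a) (c : F) : σ (C c) = C c := by
  rcases eq_or_ne c 0 with rfl | hc
  · simp
  obtain ⟨k, hk⟩ := exists_symm_coeff_C_eq φ hc
  have h1 := congrArg φ.symm (GWA.y_mul_coeff σ a (C c))
  rw [map_mul, map_mul, hk, ← Algebra.commutes, ← hk] at h1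
  exact (GWA.coeff_injective σ a
    (φ.symm.injective (mul_right_cancel₀ (symm_y_ne_zero φ) h1))).symm

theorem gwa_not_forall_apply_eq (φ : Ah h ≃+* GWA σ a) (hh : h ≠ 0) : ¬ ∀ b, σ b = b := by
  intro hσ
  have h1 : y h * x h = x h * y h := φ.injective (by
    rw [map_mul, map_mul, GWA.mul_comm_of_forall_eq hσ])
  rw [y_mul_x, add_eq_left] at h1
  exact hh (aeval_x_injective (h := h) (by rw [h1, map_zero]))

/-- If `A_h` is isomorphic to a generalized Weyl algebra `F[X](σ, a)` and `h ≠ 0`, then `σ` is a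
nontrivial translation. -/
theorem exists_gwa_apply_X (φ : Ah h ≃+* GWA σ a) (hh : h ≠ 0) :
    ∃ β : F, β ≠ 0 ∧ σ X = X + C β := by
  have hC := gwa_apply_C φ
  have hcomp := ringEquiv_apply_eq_comp σ hC
  obtain ⟨α, β, hα, hX⟩ := exists_eq_of_comp_eq_X (p := σ.symm X) (q := σ X) (by
    rw [← hcomp, σ.apply_symm_apply])
  have hs0 : σ X - X ≠ 0 := fun h0 => gwa_not_forall_apply_eq φ hh fun b => by
    rw [hcomp, sub_eq_zero.1 h0, comp_X]
  -- `s = σ X - X` is an eigenvector of `σ`, so `y s = α s y`; comparing leading coefficients in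
  -- `A_h` gives `α = 1`.
  have hs : σ (σ X - X) = C α * (σ X - X) := by
    rw [map_sub, hX, map_add, map_mul, hC, hC, hX]
    ring
  obtain ⟨k, hk⟩ := exists_symm_coeff_C_eq φ hα
  have h1 := congrArg φ.symm (GWA.y_mul_coeff σ a (σ X - X))
  rw [hs, map_mul, map_mul, map_mul, map_mul, hk, mul_assoc, ← Algebra.smul_def] at h1
  have hk1 := eq_one_of_mul_eq_smul_mul (symm_y_ne_zero φ)
    ((map_ne_zero_iff φ.symm φ.symm.injective).2
      ((map_ne_zero_iff _ (GWA.coeff_injective σ a)).2 hs0)) h1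
  have hα1 : C α = 1 := GWA.coeff_injective σ a (φ.symm.injective (by
    rw [hk, hk1, map_one, map_one, map_one]))
  rw [hα1, one_mul] at hX
  refine ⟨β, ?_, hX⟩
  rintro rfl
  exact hs0 (by rw [hX, C_0, add_zero, sub_self])

theorem isEmpty_ringEquiv_gwa (hh : ∀ c : F, h ≠ C c) (σ : F[X] ≃+* F[X]) (a : F[X]) :
    IsEmpty (Ah h ≃+* GWA σ a) := by
  refine ⟨fun φ => ?_⟩
  obtain ⟨β, hβ, hX⟩ := exists_gwa_apply_X φ (by simpa using hh 0)
  have hdeg : h.degree ≠ 0 := fun h0 => hh _ (eq_C_of_degree_eq_zero h0)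
  have : Nontrivial (AdjoinRoot h) := AdjoinRoot.nontrivial h hdeg
  let ρ : GWA σ a →+* (AdjoinRoot h)[X] := (toComm h : Ah h →+* _).comp (φ.symm : GWA σ a →+* Ah h)
  have hunit : IsUnit (ρ (GWA.coeff σ a (C β))) :=
    ((isUnit_C.2 hβ.isUnit).map (GWA.coeff σ a)).map ρ
  have hy : ρ (GWA.y σ a) = 0 := by
    have h1 := congrArg ρ (GWA.y_mul_coeff σ a X)
    rw [hX, map_mul, map_mul, map_add, map_add, add_mul, mul_comm, left_eq_add] at h1
    exact hunit.mul_right_eq_zero.1 h1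
  have hx : ρ (GWA.x σ a) = 0 := by
    have h1 := congrArg ρ (GWA.coeff_mul_x σ a X)
    rw [hX, map_mul, map_mul, map_add, map_add, mul_add, mul_comm, left_eq_add] at h1
    exact hunit.mul_left_eq_zero.1 h1
  -- Since `x` and `y` die, the image of `F[X]` is all of the image of `ρ`, so it contains the
  -- variable `ρ (φ (y h))`.
  obtain ⟨p, hp⟩ := GWA.exists_map_coeff_eq ρ hx hy (φ (y h))
  refine map_ne_X_of_map_eq_zero (ρ.comp (GWA.coeff σ a)) (gwa_ne_zero φ) ?_ p ?_
  · rw [RingHom.comp_apply, ← GWA.x_mul_y, map_mul, hx, zero_mul]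
  · rw [RingHom.comp_apply, hp]
    simp [ρ]

end Ah

theorem mainTheorem4 (F : Type*) [Field F] :
    (∀ h g : F[X],
      Nonempty (Ah h ≃ₐ[F] Ah g) ↔
        ∃ α β ν : F, α * ν ≠ 0 ∧ g = C ν * h.comp (C α * X + C β)) ∧
    (∀ h : F[X], (∀ c : F, h ≠ C c) →
      ∀ (σ : F[X] ≃+* F[X]) (a : F[X]), IsEmpty (Ah h ≃+* GWA σ a)) :=
  ⟨fun _ _ => Ah.nonempty_algEquiv_iff, fun _ hh => Ah.isEmpty_ringEquiv_gwa hh⟩
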